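/- Let $0<p'<2<p\le\infty$ and $s\ge 0$. There is a constant $C>0$, depending only on $p$, $p'$ and $s$, with the following property. Let $f:\mathbb C\to\mathbb C$ be a continuous function without zeros such that $|f|<1$ and such that the partial derivative $f_{\bar z}$, in the sense of distributions, is a locally integrable function on $\mathbb C$. Let $M\ge 1$ be a constant, let $\log (M/f)$ be a continuous branch on $\mathbb C$ of the logarithm of $M/f$, and suppose that almost everywhere on $\mathbb C$ $$|f_{\bar z}|\le A\,|f|\cdot|\log (M/f)|,$$ where $A\in L^p(\mathbb C)\cap L^{p'}(\mathbb C)$ is a real-valued function with $\|A\|_{L^p}+\|A\|_{L^{p'}}=s$. Then $f$ extends to a continuous function on the Riemann sphere $\hat{\mathbb C}=\mathbb C\cup\{\infty\}$ with values in $\mathbb C$, and $$C^{-1}\le\frac{|\log (M/f(z))|}{|\log (M/f(0))|}\le C\qquad\text{for all } z\in\mathbb C.$$ -/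

import Mathlib

open MeasureTheory
open scoped ContDiff ENNReal NNReal

/-- The classical derivative `∂φ/∂z̄ = (∂φ/∂x + i ∂φ/∂y) / 2` of a real-differentiable function. -/
noncomputable def dbar (φ : ℂ → ℂ) (z : ℂ) : ℂ :=
  (fderiv ℝ φ z 1 + Complex.I * fderiv ℝ φ z Complex.I) / 2

/-- The partial derivative by `z̄`, in the sense of distributions on `ℂ`, of the locally integrable
function `f` is the locally integrable function `h`. -/
def HasWeakDbar (f h : ℂ → ℂ) : Prop :=
  LocallyIntegrable f ∧ LocallyIntegrable h ∧
    ∀ φ : ℂ → ℂ, ContDiff ℝ ∞ φ → HasCompactSupport φ →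
      ∫ z, f z * dbar φ z = -∫ z, h z * φ z

/-- `L` is a continuous branch on `ℂ` of the logarithm of the function `u`. -/
def IsContinuousLog (L u : ℂ → ℂ) : Prop :=
  Continuous L ∧ ∀ z, Complex.exp (L z) = u z

/-! Since `‖f‖ < 1 ≤ M`, the branch `L` of log (M/f) takes values in the right half-plane, so w =
log L is continuous with bounded imaginary part. Formally w_z̄ = g := -f_z̄ / (f L), and the
hypothesis says exactly that |g| ≤ |A| almost everywhere. Pick exponents q' < 2 < q with q' > 1
between p' and p; the L^q and L^q' norms of A are bounded in terms of s
(`exists_lintegral_rpow_le`). The Cauchy kernel is integrable to a power below 2 at its pole and to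
a power above 2 at infinity, so by Hölder the Cauchy transform u of g is bounded by a constant B
depending only on p, p', s, and it vanishes at infinity (`exists_lintegral_cauchyKernel_le`,
`tendsto_lintegral_cauchyKernel`). Then w - u is weakly holomorphic with bounded imaginary part,
hence constant almost everywhere by Liouville. So w oscillates by at most 2B and has a limit at
infinity (`oscillation_le_of_weakDbar`). As |L| = exp (Re w) and f = M exp (-exp w), both claims
follow, with C = exp (2B). The delicate point is the formula for w_z̄, since f is only continuous
with a weak derivative; `integral_log_mul_dbar` obtains it by mollifying f. -/

/-! ### The operator ∂/∂z̄ and mollification -/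

theorem continuous_dbar {φ : ℂ → ℂ} (hφ : ContDiff ℝ 1 φ) : Continuous (dbar φ) := by
  have := hφ.continuous_fderiv one_ne_zero
  unfold dbar
  fun_prop

theorem fderiv_eq_zero_of_notMem_tsupport {φ : ℂ → ℂ} {z : ℂ} (hz : z ∉ tsupport φ) :
    fderiv ℝ φ z = 0 := by
  by_contra h
  exact hz (support_fderiv_subset ℝ h)

theorem dbar_eq_zero_of_notMem_tsupport {φ : ℂ → ℂ} {z : ℂ} (hz : z ∉ tsupport φ) :
    dbar φ z = 0 := by
  simp [dbar, fderiv_eq_zero_of_notMem_tsupport hz]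

theorem hasCompactSupport_dbar {φ : ℂ → ℂ} (hc : HasCompactSupport φ) :
    HasCompactSupport (dbar φ) :=
  HasCompactSupport.intro hc fun _ => dbar_eq_zero_of_notMem_tsupport

theorem integrable_dbar {φ : ℂ → ℂ} (hφ : ContDiff ℝ 1 φ) (hc : HasCompactSupport φ) :
    Integrable (dbar φ) :=
  (continuous_dbar hφ).integrable_of_hasCompactSupport (hasCompactSupport_dbar hc)

open Filter Topology Convolution ContinuousLinearMap in
/-- The derivative of a mollification of a function with a weak `∂/∂z̄` derivative is the
mollification of that derivative. -/
theorem dbar_normed_convolution {f h : ℂ → ℂ} (hfh : HasWeakDbar f h)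
    (ρ : ContDiffBump (0 : ℂ)) (x : ℂ) :
    dbar (ρ.normed volume ⋆[lsmul ℝ ℝ] f) x = (ρ.normed volume ⋆[lsmul ℝ ℝ] h) x := by
  obtain ⟨hf, hh, H⟩ := hfh
  have hρ : ContDiff ℝ ∞ (ρ.normed volume : ℂ → ℝ) := ρ.contDiff_normed
  have hcs : HasCompactSupport (ρ.normed volume : ℂ → ℝ) := ρ.hasCompactSupport_normed
  have hd := hcs.hasFDerivAt_convolution_left (lsmul ℝ ℝ : ℝ →L[ℝ] ℂ →L[ℝ] ℂ)
    (hρ.of_le (by exact_mod_cast le_top)) hf x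
  have hρd : Differentiable ℝ (ρ.normed volume : ℂ → ℝ) := hρ.differentiable (by simp)
  have hcont : Continuous (fderiv ℝ (ρ.normed volume : ℂ → ℝ)) := hρ.continuous_fderiv (by simp)
  have key : ∀ v : ℂ, Integrable (fun t => (fderiv ℝ (ρ.normed volume) (x - t) v) • f t) ∧
      fderiv ℝ (ρ.normed volume ⋆[lsmul ℝ ℝ] f) x v =
        ∫ t, (fderiv ℝ (ρ.normed volume) (x - t) v) • f t := by
    intro v
    have hci := (hcs.fderiv (𝕜 := ℝ)).convolutionExists_left
      ((lsmul ℝ ℝ : ℝ →L[ℝ] ℂ →L[ℝ] ℂ).precompL ℂ) hcont hf x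
    have hci' := hci.integrable_swap
    rw [hd.fderiv, convolution_eq_swap, ContinuousLinearMap.integral_apply hci']
    refine ⟨?_, rfl⟩
    exact ((ContinuousLinearMap.apply ℝ ℂ v).integrable_comp hci' :)
  -- The test function is the reflected, translated bump t ↦ ρ(x - t). The reflection changes the
  -- sign of its derivative, cancelling the sign in the weak formula.
  have hφ : ContDiff ℝ ∞ (fun t => ((ρ.normed volume (x - t) : ℝ) : ℂ)) :=
    Complex.ofRealCLM.contDiff.comp (hρ.comp (contDiff_const.sub contDiff_id))
  have hφc : HasCompactSupport (fun t => ((ρ.normed volume (x - t) : ℝ) : ℂ)) := by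
    have h1 : HasCompactSupport (fun t => ρ.normed volume (x - t)) :=
      hcs.comp_homeomorph (Homeomorph.subLeft x)
    exact h1.comp_left Complex.ofReal_zero
  have hφd : ∀ t v, fderiv ℝ (fun t => ((ρ.normed volume (x - t) : ℝ) : ℂ)) t v =
      -((fderiv ℝ (ρ.normed volume) (x - t) v : ℝ) : ℂ) := by
    intro t v
    have h1 : HasFDerivAt (fun t : ℂ => x - t) (-ContinuousLinearMap.id ℝ ℂ) t :=
      (hasFDerivAt_id t).const_sub x
    have h2 := (Complex.ofRealCLM.hasFDerivAt).comp t
      (((hρd (x - t)).hasFDerivAt).comp t h1)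
    have h3 := h2.fderiv
    simp only [Function.comp_def, Complex.ofRealCLM_apply] at h3
    rw [h3]
    simp
  have hw := H _ hφ hφc
  rw [dbar, (key 1).2, (key Complex.I).2, ← integral_const_mul,
    ← integral_add (key 1).1 ((key Complex.I).1.const_mul _), ← integral_div, convolution_eq_swap]
  simp only [dbar, hφd] at hw
  calc _ = ∫ t, -(f t * ((-((fderiv ℝ (ρ.normed volume) (x - t) 1 : ℝ) : ℂ) + Complex.I *
        -((fderiv ℝ (ρ.normed volume) (x - t) Complex.I : ℝ) : ℂ)) / 2)) := by
        refine integral_congr_ae (Eventually.of_forall fun t => ?_)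
        simp only [Complex.real_smul]
        ring
    _ = _ := by
        rw [integral_neg, hw, neg_neg]
        refine integral_congr_ae (Eventually.of_forall fun t => ?_)
        simp [mul_comm]

/-! ### A Liouville theorem for weakly holomorphic functions -/

/-- A real-differentiable function with vanishing `∂/∂z̄` derivative is complex differentiable. -/
theorem differentiableAt_of_dbar_eq_zero {f : ℂ → ℂ} {x : ℂ} (hf : DifferentiableAt ℝ f x)
    (h : dbar f x = 0) : DifferentiableAt ℂ f x := by
  rw [differentiableAt_complex_iff_differentiableAt_real]
  refine ⟨hf, ?_⟩
  have h1 : fderiv ℝ f x 1 + Complex.I * fderiv ℝ f x Complex.I = 0 := by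
    simpa [dbar] using h
  rw [smul_eq_mul]
  linear_combination (-Complex.I) * h1 + fderiv ℝ f x Complex.I * Complex.I_sq

/-- An entire function with bounded imaginary part is constant. -/
theorem differentiable_apply_eq_of_im_bounded {F : ℂ → ℂ} (hF : Differentiable ℂ F) {b : ℝ}
    (hb : ∀ z, |(F z).im| ≤ b) (z z' : ℂ) : F z = F z' := by
  -- |exp(iF)| = exp(-Im F) is bounded, so exp(iF) is constant, and its derivative iF' exp(iF) can
  -- vanish only if F' does.
  have hd : Differentiable ℂ fun z => Complex.exp (Complex.I * F z) :=
    (hF.const_mul _).cexp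
  have hbd : Bornology.IsBounded (Set.range fun z => Complex.exp (Complex.I * F z)) := by
    rw [isBounded_iff_forall_norm_le]
    refine ⟨Real.exp b, ?_⟩
    rintro _ ⟨z, rfl⟩
    rw [Complex.norm_exp]
    gcongr
    simpa using (neg_le_abs _).trans (hb z)
  have hder : ∀ x, deriv F x = 0 := by
    intro x
    have h1 : (fun z => Complex.exp (Complex.I * F z)) = fun _ => Complex.exp (Complex.I * F x) :=
      funext fun y => hd.apply_eq_apply_of_bounded hbd y x
    have h2 := (((hF x).hasDerivAt.const_mul Complex.I).cexp)
    rw [h1] at h2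
    have h3 := h2.unique (hasDerivAt_const x _)
    simpa [Complex.exp_ne_zero] using h3
  exact is_const_of_deriv_eq_zero hF hder z z'

/-- The standard sequence of bump functions on `ℂ` shrinking to the origin. -/
noncomputable def shrinkingBump (n : ℕ) : ContDiffBump (0 : ℂ) where
  rIn := 1 / (2 * ((n : ℝ) + 1))
  rOut := 1 / ((n : ℝ) + 1)
  rIn_pos := by positivity
  rIn_lt_rOut := by
    apply one_div_lt_one_div_of_lt <;> linarith [(Nat.cast_nonneg n : (0 : ℝ) ≤ n)]

theorem tendsto_rOut_shrinkingBump :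
    Filter.Tendsto (fun n => (shrinkingBump n).rOut) Filter.atTop (nhds 0) :=
  tendsto_one_div_add_atTop_nhds_zero_nat

theorem rOut_shrinkingBump_le_one (n : ℕ) : (shrinkingBump n).rOut ≤ 1 := by
  simp only [shrinkingBump]
  rw [div_le_one (by positivity)]
  linarith [(Nat.cast_nonneg n : (0 : ℝ) ≤ n)]

open Convolution ContinuousLinearMap in
/-- A mollification is bounded by any bound of the function near the point. -/
theorem norm_normed_convolution_le {E : Type*} [NormedAddCommGroup E] [NormedSpace ℝ E]
    [CompleteSpace E] {ρ : ContDiffBump (0 : ℂ)} {g : ℂ → E} {x : ℂ} {c : ℝ}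
    (hg : AEStronglyMeasurable g) (hc : ∀ y ∈ Metric.ball x ρ.rOut, ‖g y‖ ≤ c) :
    ‖(ρ.normed volume ⋆[lsmul ℝ ℝ] g) x‖ ≤ c := by
  have := dist_convolution_le (μ := (volume : Measure ℂ)) (z₀ := (0 : E)) (x₀ := x)
    (f := ρ.normed volume) (g := g)
    ((norm_nonneg _).trans (hc x (Metric.mem_ball_self ρ.rOut_pos)))
    ρ.support_normed_eq.subset ρ.nonneg_normed ρ.integral_normed hg (by simpa using hc)
  simpa using this

open Filter Topology Convolution ContinuousLinearMap in
/-- A Liouville theorem: if `w` is continuous with bounded imaginary part and differs from the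
bounded function `u` by a weakly holomorphic function, then oscillations of `w` are controlled
by those of `u`. -/
theorem norm_sub_le_of_hasWeakDbar_zero {w u : ℂ → ℂ} {b B : ℝ} (hw : Continuous w)
    (hwb : ∀ z, |(w z).im| ≤ b) (hu : AEStronglyMeasurable u) (huB : ∀ z, ‖u z‖ ≤ B)
    (h0 : HasWeakDbar (fun z => w z - u z) 0) {z z' : ℂ} {η r : ℝ} (hr : 0 < r)
    (hz : ∀ x ∈ Metric.ball z r, ‖u x‖ ≤ η) (hz' : ∀ x ∈ Metric.ball z' r, ‖u x‖ ≤ η) :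
    ‖w z - w z'‖ ≤ 2 * η := by
  have huL : LocallyIntegrable u := by
    rw [locallyIntegrable_iff]
    exact fun K hK => Measure.integrableOn_of_bounded hK.measure_lt_top.ne hu
      (Eventually.of_forall huB)
  let ρ := fun n => (shrinkingBump n).normed (volume : Measure ℂ)
  have hcs : ∀ n, HasCompactSupport (ρ n) := fun n => (shrinkingBump n).hasCompactSupport_normed
  have hsm : ∀ n, ContDiff ℝ 1 (ρ n) := fun n => (shrinkingBump n).contDiff_normed
  have hsub : ∀ n x, (ρ n ⋆[lsmul ℝ ℝ] fun z => w z - u z) x =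
      (ρ n ⋆[lsmul ℝ ℝ] w) x - (ρ n ⋆[lsmul ℝ ℝ] u) x := by
    intro n x
    have e1 := (hcs n).convolutionExists_left (lsmul ℝ ℝ : ℝ →L[ℝ] ℂ →L[ℝ] ℂ)
      (hsm n).continuous (hw.locallyIntegrable (μ := volume)) x
    have e2 := (hcs n).convolutionExists_left (lsmul ℝ ℝ : ℝ →L[ℝ] ℂ →L[ℝ] ℂ)
      (hsm n).continuous huL x
    simp only [convolution_def, map_sub]
    exact integral_sub e1.integrable e2.integrable
  -- Mollifying makes weak holomorphy classical and preserves the bounds, so Liouville applies for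
  -- each n.
  have hdiff : ∀ n, Differentiable ℂ (ρ n ⋆[lsmul ℝ ℝ] fun z => w z - u z) := by
    intro n x
    refine differentiableAt_of_dbar_eq_zero
      ((hcs n).hasFDerivAt_convolution_left (lsmul ℝ ℝ : ℝ →L[ℝ] ℂ →L[ℝ] ℂ) (hsm n) h0.1
        x).differentiableAt ?_
    rw [dbar_normed_convolution h0, convolution_zero, Pi.zero_apply]
  have hconst : ∀ n, (ρ n ⋆[lsmul ℝ ℝ] fun z => w z - u z) z =
      (ρ n ⋆[lsmul ℝ ℝ] fun z => w z - u z) z' := by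
    intro n
    refine differentiable_apply_eq_of_im_bounded (hdiff n) (b := b + B) (fun x => ?_) z z'
    have e1 := (hcs n).convolutionExists_left (lsmul ℝ ℝ : ℝ →L[ℝ] ℂ →L[ℝ] ℂ)
      (hsm n).continuous (hw.locallyIntegrable (μ := volume)) x
    have him : ((ρ n ⋆[lsmul ℝ ℝ] w) x).im = (ρ n ⋆[lsmul ℝ ℝ] fun z => (w z).im) x := by
      simp only [convolution_def]
      rw [← Complex.imCLM_apply, ← Complex.imCLM.integral_comp_comm e1.integrable]
      simp
    rw [hsub, Complex.sub_im, him]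
    refine (abs_sub _ _).trans (add_le_add ?_ ((Complex.abs_im_le_norm _).trans ?_))
    · exact norm_normed_convolution_le (Complex.continuous_im.comp hw).aestronglyMeasurable
        fun y _ => hwb y
    · exact norm_normed_convolution_le hu fun y _ => huB y
  -- Only the mollifications of w must converge pointwise; those of u are merely bounded through the
  -- values of u near the two points, so u need not be continuous.
  have hlim : Tendsto (fun n => ‖(ρ n ⋆[lsmul ℝ ℝ] w) z - (ρ n ⋆[lsmul ℝ ℝ] w) z'‖) atTop
      (𝓝 ‖w z - w z'‖) :=
    ((ContDiffBump.convolution_tendsto_right_of_continuous tendsto_rOut_shrinkingBump hw z).sub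
      (ContDiffBump.convolution_tendsto_right_of_continuous tendsto_rOut_shrinkingBump hw
        z')).norm
  refine le_of_tendsto hlim ?_
  filter_upwards [tendsto_rOut_shrinkingBump.eventually (gt_mem_nhds hr)] with n hn
  have hc := hconst n
  rw [hsub, hsub] at hc
  have heq : (ρ n ⋆[lsmul ℝ ℝ] w) z - (ρ n ⋆[lsmul ℝ ℝ] w) z' =
      (ρ n ⋆[lsmul ℝ ℝ] u) z - (ρ n ⋆[lsmul ℝ ℝ] u) z' := by linear_combination hc
  rw [heq, two_mul]
  exact (norm_sub_le _ _).trans (add_le_add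
    (norm_normed_convolution_le hu fun y hy => hz y (Metric.ball_subset_ball hn.le hy))
    (norm_normed_convolution_le hu fun y hy => hz' y (Metric.ball_subset_ball hn.le hy)))

/-! ### The Cauchy–Pompeiu formula -/

open Filter Topology Set in
/-- The Cauchy–Pompeiu formula for compactly supported functions. -/
theorem integral_dbar_div_sub {φ : ℂ → ℂ} (hφ : ContDiff ℝ 1 φ) (hc : HasCompactSupport φ)
    (ζ : ℂ) : ∫ z, dbar φ z / (z - ζ) = -(Real.pi * φ ζ) := by
  obtain ⟨R, hR0, hR⟩ : ∃ R : ℝ, 0 < R ∧ ∀ z, R ≤ ‖z‖ → φ z = 0 ∧ fderiv ℝ φ z = 0 := by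
    obtain ⟨R, hR⟩ := hc.isCompact.isBounded.subset_ball 0
    refine ⟨max R 1, by positivity, fun z hz => ?_⟩
    have hz' : z ∉ tsupport φ := fun h => by
      have := hR h
      rw [mem_ball_zero_iff] at this
      linarith [le_max_left R 1]
    exact ⟨image_eq_zero_of_notMem_tsupport hz', fderiv_eq_zero_of_notMem_tsupport hz'⟩
  set e : ℝ → ℂ := fun θ => Real.cos θ + Real.sin θ * Complex.I with he
  have hec : Continuous e := by fun_prop
  have hen : ∀ θ, ‖e θ‖ = 1 := fun θ => by
    have : e θ = Complex.exp (θ * Complex.I) := by simp [he, Complex.exp_mul_I]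
    rw [this, Complex.norm_exp_ofReal_mul_I]
  have hed : ∀ θ, HasDerivAt e (Complex.I * e θ) θ := fun θ => by
    have h1 := ((Real.hasDerivAt_cos θ).ofReal_comp).add
      (((Real.hasDerivAt_sin θ).ofReal_comp).mul_const Complex.I)
    refine h1.congr_deriv ?_
    simp only [he, Complex.ofReal_neg]
    linear_combination - (Real.sin θ : ℂ) * Complex.I_sq
  have hφd : Differentiable ℝ φ := hφ.differentiable one_ne_zero
  have hfc : Continuous (fderiv ℝ φ) := hφ.continuous_fderiv one_ne_zero
  set P : ℝ → ℝ → ℂ := fun r θ => ζ + r * e θ with hP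
  have hPc : Continuous fun p : ℝ × ℝ => P p.1 p.2 := by fun_prop
  have hPn : ∀ r θ, ‖ζ‖ + R ≤ r → R ≤ ‖P r θ‖ := fun r θ hr => by
    have h1 : ‖(r : ℂ) * e θ‖ ≤ ‖P r θ‖ + ‖ζ‖ := by
      have : (r : ℂ) * e θ = P r θ - ζ := by simp [hP]
      rw [this]
      exact norm_sub_le _ _
    rw [norm_mul, hen, mul_one, Complex.norm_real, Real.norm_eq_abs] at h1
    linarith [le_abs_self r]
  have hint : ∀ v : ℝ → ℂ, Continuous v →
      IntegrableOn (fun p : ℝ × ℝ => fderiv ℝ φ (P p.1 p.2) (v p.2))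
        (Ioi 0 ×ˢ Ioo (-Real.pi) Real.pi) := by
    intro v hv
    have hcont : Continuous fun p : ℝ × ℝ => fderiv ℝ φ (P p.1 p.2) (v p.2) :=
      (hfc.comp hPc).clm_apply (hv.comp continuous_snd)
    have hK : IntegrableOn (fun p : ℝ × ℝ => fderiv ℝ φ (P p.1 p.2) (v p.2))
        (Icc 0 (‖ζ‖ + R) ×ˢ Icc (-Real.pi) Real.pi) :=
      hcont.continuousOn.integrableOn_compact (isCompact_Icc.prod isCompact_Icc)
    refine hK.of_forall_sdiff_eq_zero (measurableSet_Ioi.prod measurableSet_Ioo) ?_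
    rintro ⟨r, θ⟩ ⟨⟨h1, h2⟩, h3⟩
    have hr : ‖ζ‖ + R ≤ r := by
      by_contra! h
      exact h3 ⟨⟨le_of_lt h1, h.le⟩, ⟨h2.1.le, h2.2.le⟩⟩
    simp [(hR _ (hPn r θ hr)).2]
  -- Radial part: along each ray from ζ the integral telescopes to -φ(ζ).
  have hA : ∫ p in Ioi 0 ×ˢ Ioo (-Real.pi) Real.pi, fderiv ℝ φ (P p.1 p.2) (e p.2) =
      -(2 * Real.pi * φ ζ) := by
    rw [Measure.volume_eq_prod, setIntegral_prod _ (hint e hec), integral_integral_swap]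
    · have : ∀ θ : ℝ, ∫ r in Ioi (0 : ℝ), fderiv ℝ φ (P r θ) (e θ) = -φ ζ := by
        intro θ
        have hd : ∀ r ∈ Ici (0 : ℝ), HasDerivAt (fun r : ℝ => φ (P r θ))
            (fderiv ℝ φ (P r θ) (e θ)) r := by
          intro r _
          have h1 : HasDerivAt (fun r : ℝ => P r θ) (e θ) r := by
            exact ((((hasDerivAt_id r).ofReal_comp).mul_const (e θ)).const_add ζ).congr_deriv
              (by simp)
          exact (hφd (P r θ)).hasFDerivAt.comp_hasDerivAt r h1
        have hlim : Tendsto (fun r : ℝ => φ (P r θ)) atTop (𝓝 0) := by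
          refine tendsto_const_nhds.congr' ?_
          filter_upwards [eventually_ge_atTop (‖ζ‖ + R)] with r hr
          exact (hR _ (hPn r θ hr)).1.symm
        have hi : IntegrableOn (fun r : ℝ => fderiv ℝ φ (P r θ) (e θ)) (Ioi 0) := by
          have hcont : Continuous fun r : ℝ => fderiv ℝ φ (P r θ) (e θ) :=
            (hfc.comp (hPc.comp (Continuous.prodMk_left θ))).clm_apply continuous_const
          refine (hcont.continuousOn.integrableOn_compact
            (isCompact_Icc (a := 0) (b := ‖ζ‖ + R))).of_forall_sdiff_eq_zero measurableSet_Ioi ?_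
          rintro r ⟨h1, h3⟩
          have hr : ‖ζ‖ + R ≤ r := by
            by_contra! h
            exact h3 ⟨le_of_lt h1, h.le⟩
          simp [(hR _ (hPn r θ hr)).2]
        rw [integral_Ioi_of_hasDerivAt_of_tendsto' hd hi hlim]
        simp [hP]
      simp only [this]
      rw [setIntegral_const]
      simp only [measureReal_def, Real.volume_Ioo]
      rw [ENNReal.toReal_ofReal (by linarith [Real.pi_pos])]
      simp only [Complex.real_smul]
      push_cast
      ring
    · have := hint e hec
      rwa [IntegrableOn, Measure.volume_eq_prod, ← Measure.prod_restrict] at this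
  -- Angular part: φ is periodic on each circle about ζ, so its angular derivative integrates to 0.
  have hB : ∫ p in Ioi 0 ×ˢ Ioo (-Real.pi) Real.pi,
      fderiv ℝ φ (P p.1 p.2) (Complex.I * e p.2) = 0 := by
    rw [Measure.volume_eq_prod, setIntegral_prod _ (hint (fun θ => Complex.I * e θ) (by fun_prop))]
    refine setIntegral_eq_zero_of_forall_eq_zero fun r hr => ?_
    have hr : (0 : ℝ) < r := hr
    have hd : ∀ θ : ℝ, HasDerivAt (fun θ : ℝ => φ (P r θ))
        (r * fderiv ℝ φ (P r θ) (Complex.I * e θ)) θ := by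
      intro θ
      have h1 : HasDerivAt (fun θ : ℝ => P r θ) (r • (Complex.I * e θ)) θ := by
        exact (((hed θ).const_mul (r : ℂ)).const_add ζ).congr_deriv (by simp)
      have h2 := (hφd (P r θ)).hasFDerivAt.comp_hasDerivAt θ h1
      rw [map_smul, Complex.real_smul] at h2
      exact h2
    have hcont : Continuous fun θ : ℝ => r * fderiv ℝ φ (P r θ) (Complex.I * e θ) :=
      continuous_const.mul ((hfc.comp (hPc.comp (Continuous.prodMk_right r))).clm_apply
        (by fun_prop))
    have h3 := intervalIntegral.integral_eq_sub_of_hasDerivAt (a := -Real.pi) (b := Real.pi)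
      (fun θ _ => hd θ) (hcont.intervalIntegrable _ _)
    have h4 : P r Real.pi = P r (-Real.pi) := by simp [hP, he]
    rw [h4, sub_self, intervalIntegral.integral_of_le (by linarith [Real.pi_pos]),
      integral_Ioc_eq_integral_Ioo, integral_const_mul] at h3
    have hr' : (r : ℂ) ≠ 0 := by exact_mod_cast hr.ne'
    exact (mul_eq_zero.mp h3).resolve_left hr'
  have htr : ∫ z, dbar φ z / (z - ζ) = ∫ z, dbar φ (ζ + z) / z := by
    rw [← integral_add_left_eq_self _ ζ]
    simp
  rw [htr, ← Complex.integral_comp_polarCoord_symm]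
  -- The Jacobian r cancels the modulus of 1/(z - ζ), and ∂/∂z̄ = (e^{iθ}/2)(∂_r + (i/r) ∂_θ), whose
  -- phase cancels as well.
  have hcongr : ∀ p ∈ polarCoord.target,
      p.1 • (dbar φ (ζ + Complex.polarCoord.symm p) / Complex.polarCoord.symm p) =
      (fderiv ℝ φ (P p.1 p.2) (e p.2) +
        Complex.I * fderiv ℝ φ (P p.1 p.2) (Complex.I * e p.2)) / 2 := by
    rintro ⟨r, θ⟩ hp
    have hr : (0 : ℝ) < r := by
      rw [polarCoord_target] at hp
      exact hp.1
    have hr' : (r : ℂ) ≠ 0 := by exact_mod_cast hr.ne'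
    have he0 : e θ ≠ 0 := fun h => by simpa [h] using hen θ
    have hsym : Complex.polarCoord.symm (r, θ) = r * e θ := by
      simp [he]
    rw [hsym]
    have h1 : ζ + r * e θ = P r θ := rfl
    rw [h1, dbar, Complex.real_smul]
    have h2 : fderiv ℝ φ (P r θ) (e θ) = Real.cos θ * fderiv ℝ φ (P r θ) 1 +
        Real.sin θ * fderiv ℝ φ (P r θ) Complex.I := by
      have : e θ = Real.cos θ • (1 : ℂ) + Real.sin θ • Complex.I := by simp [he]
      rw [this, map_add, map_smul, map_smul, Complex.real_smul, Complex.real_smul]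
    have h3 : fderiv ℝ φ (P r θ) (Complex.I * e θ) = -Real.sin θ * fderiv ℝ φ (P r θ) 1 +
        Real.cos θ * fderiv ℝ φ (P r θ) Complex.I := by
      have : Complex.I * e θ = (-Real.sin θ) • (1 : ℂ) + Real.cos θ • Complex.I := by
        simp only [he, Complex.real_smul]
        push_cast
        linear_combination (Complex.sin θ : ℂ) * Complex.I_sq
      rw [this, map_add, map_smul, map_smul, Complex.real_smul, Complex.real_smul]
      push_cast
      ring
    simp only [h2, h3]
    have h5 : (Real.cos θ : ℂ) * Real.cos θ + (Real.sin θ : ℂ) * Real.sin θ = 1 := by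
      exact_mod_cast (by nlinarith [Real.sin_sq_add_cos_sq θ] :
        Real.cos θ * Real.cos θ + Real.sin θ * Real.sin θ = 1)
    have h6 : (e θ)⁻¹ = Real.cos θ - Real.sin θ * Complex.I := by
      refine (eq_inv_of_mul_eq_one_left ?_).symm
      simp only [he]
      linear_combination h5 - (Real.sin θ : ℂ) * Real.sin θ * Complex.I_sq
    have h7 : (r : ℂ) * ((fderiv ℝ φ (P r θ) 1 + Complex.I * fderiv ℝ φ (P r θ) Complex.I) / 2 /
        (r * e θ)) = (fderiv ℝ φ (P r θ) 1 + Complex.I * fderiv ℝ φ (P r θ) Complex.I) / 2 *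
        (e θ)⁻¹ := by
      field_simp
    rw [h7, h6]
    linear_combination (-(Real.sin θ : ℂ) * fderiv ℝ φ (P r θ) Complex.I / 2) * Complex.I_sq
  rw [setIntegral_congr_fun (by rw [polarCoord_target]; exact measurableSet_Ioi.prod measurableSet_Ioo)
    hcongr, polarCoord_target, integral_div, integral_add (hint e hec)
    ((hint (fun θ => Complex.I * e θ) (by fun_prop)).const_mul _), integral_const_mul, hA, hB]
  ring

/-! ### The Cauchy transform -/

/-- The Cauchy transform, a right inverse of `∂/∂z̄`. -/
noncomputable def cauchyTransform (g : ℂ → ℂ) (z : ℂ) : ℂ :=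
  (Real.pi : ℂ)⁻¹ * ∫ ζ, g ζ / (z - ζ)

theorem aestronglyMeasurable_cauchyKernel {g : ℂ → ℂ} (hg : AEStronglyMeasurable g) :
    AEStronglyMeasurable (fun p : ℂ × ℂ => g p.2 / (p.1 - p.2))
      ((volume : Measure ℂ).prod volume) := by
  have h1 : AEStronglyMeasurable (fun p : ℂ × ℂ => g p.2) ((volume : Measure ℂ).prod volume) :=
    hg.comp_snd
  have h2 : Measurable (fun p : ℂ × ℂ => (p.1 - p.2)⁻¹) :=
    (measurable_fst.sub measurable_snd).inv
  simp only [div_eq_mul_inv]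
  exact h1.mul h2.aestronglyMeasurable

theorem aestronglyMeasurable_cauchyTransform {g : ℂ → ℂ} (hg : AEStronglyMeasurable g) :
    AEStronglyMeasurable (cauchyTransform g) :=
  (aestronglyMeasurable_cauchyKernel hg).integral_prod_right'.const_mul _

/-- The Cauchy transform of `g` has weak `∂/∂z̄` derivative `g`. -/
theorem integral_cauchyTransform_mul_dbar {g : ℂ → ℂ} (hg : AEStronglyMeasurable g)
    {B : ℝ≥0∞} (hB : B ≠ ⊤) (hgB : ∀ z, ∫⁻ ζ, ‖g ζ / (z - ζ)‖ₑ ≤ B) {φ : ℂ → ℂ}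
    (hφ : ContDiff ℝ 1 φ) (hc : HasCompactSupport φ) :
    ∫ z, cauchyTransform g z * dbar φ z = -∫ z, g z * φ z := by
  have hdc := continuous_dbar hφ
  have hdi := integrable_dbar hφ hc
  -- Absolute integrability for Fubini: the inner integral is at most B times the integrable
  -- |∂φ/∂z̄|.
  have hI : Integrable (fun p : ℂ × ℂ => g p.2 / (p.1 - p.2) * dbar φ p.1)
      ((volume : Measure ℂ).prod volume) := by
    have hm : AEStronglyMeasurable (fun p : ℂ × ℂ => g p.2 / (p.1 - p.2) * dbar φ p.1)
      ((volume : Measure ℂ).prod volume) := (aestronglyMeasurable_cauchyKernel hg).mul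
        (hdc.comp continuous_fst).aestronglyMeasurable
    refine ⟨hm, ?_⟩
    rw [HasFiniteIntegral, lintegral_prod _ hm.enorm]
    have hle : ∀ z, ∫⁻ ζ, ‖g ζ / (z - ζ) * dbar φ z‖ₑ ≤ B * ‖dbar φ z‖ₑ := by
      intro z
      simp only [enorm_mul]
      rw [lintegral_mul_const' _ _ enorm_ne_top]
      gcongr
      exact hgB z
    refine (lintegral_mono hle).trans_lt ?_
    rw [lintegral_const_mul' _ _ hB]
    exact ENNReal.mul_lt_top hB.lt_top hdi.2
  have hpi : (Real.pi : ℂ) ≠ 0 := by exact_mod_cast Real.pi_ne_zero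
  calc ∫ z, cauchyTransform g z * dbar φ z
      = (Real.pi : ℂ)⁻¹ * ∫ z, ∫ ζ, g ζ / (z - ζ) * dbar φ z := by
        rw [← integral_const_mul]
        simp only [cauchyTransform, integral_mul_const, mul_assoc]
    _ = (Real.pi : ℂ)⁻¹ * ∫ ζ, ∫ z, g ζ / (z - ζ) * dbar φ z := by
        rw [integral_integral_swap hI]
    _ = (Real.pi : ℂ)⁻¹ * ∫ ζ, g ζ * -(Real.pi * φ ζ) := by
        congr 2
        ext ζ
        rw [← integral_dbar_div_sub hφ hc ζ, ← integral_const_mul]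
        congr 1
        ext z
        ring
    _ = -∫ z, g z * φ z := by
        rw [← integral_const_mul, ← integral_neg]
        congr 1
        ext ζ
        field_simp

/-! ### Estimates for the Cauchy kernel -/

-- In polar coordinates the integrand becomes y^(1 - r), integrable at 0 because r < 2.
open Set in
theorem lintegral_ball_enorm_inv_rpow_lt_top {r : ℝ} (hr : 0 < r) (hr2 : r < 2) :
    ∫⁻ ζ : ℂ in Metric.ball 0 1, ‖ζ⁻¹‖ₑ ^ r < ⊤ := by
  have h1 : IntegrableOn (fun y : ℝ => y ^ (Module.finrank ℝ ℂ - 1) • y ^ (-r)) (Ioo 0 1) := by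
    have h2 : IntegrableOn (fun y : ℝ => y ^ (1 - r)) (Ioo 0 1) :=
      (intervalIntegral.integrableOn_Ioo_rpow_iff one_pos).2 (by linarith)
    refine h2.congr_fun (fun y hy => ?_) measurableSet_Ioo
    have hy0 : 0 < y := hy.1
    simp only [Complex.finrank_real_complex, smul_eq_mul]
    rw [sub_eq_add_neg, Real.rpow_add hy0]
    simp
  have h3 := (integrableOn_fun_norm_addHaar (E := ℂ) (μ := volume)
    (f := fun y : ℝ => y ^ (-r))).2 h1
  refine lt_of_eq_of_lt (lintegral_congr fun ζ => ?_) h3.2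
  rw [← ofReal_norm, ENNReal.ofReal_rpow_of_nonneg (norm_nonneg _) hr.le, norm_inv,
    Real.inv_rpow (norm_nonneg _), ← Real.rpow_neg (norm_nonneg _),
    Real.enorm_of_nonneg (by positivity)]

-- Counterpart at infinity: y^(1 - r) is integrable on [1, ∞) because r > 2.
open Set in
theorem lintegral_compl_ball_enorm_inv_rpow_lt_top {r : ℝ} (hr2 : 2 < r) :
    ∫⁻ ζ : ℂ in (Metric.ball 0 1)ᶜ, ‖ζ⁻¹‖ₑ ^ r < ⊤ := by
  have h1 : IntegrableOn (fun y : ℝ => y ^ (Module.finrank ℝ ℂ - 1) •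
      (Ici (1 : ℝ)).indicator (fun y => y ^ (-r)) y) (Ioi 0) := by
    have h2 : IntegrableOn (fun y : ℝ => y ^ (1 - r)) (Ici 1) := by
      rw [integrableOn_Ici_iff_integrableOn_Ioi]
      exact integrableOn_Ioi_rpow_of_lt (by linarith) one_pos
    have h4 : Integrable ((Ici (1 : ℝ)).indicator fun y : ℝ => y ^ (1 - r)) :=
      (integrable_indicator_iff measurableSet_Ici).2 h2
    refine (h4.integrableOn (s := Ioi 0)).congr_fun (fun y hy => ?_) measurableSet_Ioi
    have hy0 : 0 < y := hy
    by_cases hy1 : y ∈ Ici (1 : ℝ)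
    · simp only [indicator_of_mem hy1, Complex.finrank_real_complex, smul_eq_mul]
      rw [sub_eq_add_neg, Real.rpow_add hy0]
      simp
    · simp [indicator_of_notMem hy1]
  have h3 := (integrable_fun_norm_addHaar (E := ℂ) (volume : Measure ℂ)
    (f := (Ici (1 : ℝ)).indicator fun y : ℝ => y ^ (-r))).2 h1
  rw [← lintegral_indicator Metric.isOpen_ball.measurableSet.compl]
  refine lt_of_eq_of_lt (lintegral_congr fun ζ => ?_) h3.2
  by_cases hζ : ζ ∈ (Metric.ball (0 : ℂ) 1)ᶜ
  · have hζ' : ‖ζ‖ ∈ Ici (1 : ℝ) := by simpa using hζ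
    beta_reduce
    rw [indicator_of_mem hζ, indicator_of_mem hζ', ← ofReal_norm,
      ENNReal.ofReal_rpow_of_nonneg (norm_nonneg _) (by linarith), norm_inv,
      Real.inv_rpow (norm_nonneg _), ← Real.rpow_neg (norm_nonneg _),
      Real.enorm_of_nonneg (by positivity)]
  · have hζ' : ‖ζ‖ ∉ Ici (1 : ℝ) := by simpa using hζ
    beta_reduce
    rw [indicator_of_notMem hζ, indicator_of_notMem hζ', enorm_zero]

/-- The Cauchy kernel is the sum of an `L^r` function, `r < 2`, and an `L^r'` function, `2 < r'`;
so its convolutions with functions in `L^q ∩ L^q'`, `q' < 2 < q`, are uniformly bounded. -/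
theorem exists_lintegral_cauchyKernel_le {q q' : ℝ} (hq : 2 < q) (hq'1 : 1 < q') (hq' : q' < 2) :
    ∃ K : ℝ≥0, ∀ a : ℂ → ℝ≥0∞, AEMeasurable a → ∀ z, ∫⁻ ζ, a ζ * ‖(z - ζ)⁻¹‖ₑ ≤
      K * ((∫⁻ ζ, a ζ ^ q) ^ (1 / q) + (∫⁻ ζ, a ζ ^ q') ^ (1 / q')) := by
  -- Conjugation swaps the sides of 2: q > 2 pairs with the kernel near its pole, q' < 2 with its
  -- tail.
  have hc : q.HolderConjugate (Real.conjExponent q) := .conjExponent (by linarith)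
  have hc' : q'.HolderConjugate (Real.conjExponent q') := .conjExponent hq'1
  have hr : Real.conjExponent q < 2 := by
    rw [Real.conjExponent, div_lt_iff₀ (by linarith)]
    linarith
  have hr' : 2 < Real.conjExponent q' := by
    rw [Real.conjExponent, lt_div_iff₀ (by linarith)]
    linarith
  have hr0 := hc.symm.pos
  have hr0' := hc'.symm.pos
  set r := Real.conjExponent q
  set r' := Real.conjExponent q'
  have hI := lintegral_ball_enorm_inv_rpow_lt_top hr0 hr
  have hI' := lintegral_compl_ball_enorm_inv_rpow_lt_top hr'
  set I := ∫⁻ ζ : ℂ in Metric.ball 0 1, ‖ζ⁻¹‖ₑ ^ r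
  set I' := ∫⁻ ζ : ℂ in (Metric.ball 0 1)ᶜ, ‖ζ⁻¹‖ₑ ^ r'
  have hm : Measurable fun ζ : ℂ => ‖ζ⁻¹‖ₑ := measurable_inv.enorm
  have hball : MeasurableSet (Metric.ball (0 : ℂ) 1) := Metric.isOpen_ball.measurableSet
  have holder : ∀ {p s : ℝ}, p.HolderConjugate s → ∀ {S : Set ℂ}, MeasurableSet S →
      ∀ a : ℂ → ℝ≥0∞, AEMeasurable a → ∀ z,
      ∫⁻ ζ, a ζ * S.indicator (fun ζ => ‖ζ⁻¹‖ₑ) (z - ζ) ≤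
        (∫⁻ ζ, a ζ ^ p) ^ (1 / p) * (∫⁻ ζ in S, ‖ζ⁻¹‖ₑ ^ s) ^ (1 / s) := by
    intro p s hps S hS a ha z
    have hk : Measurable (S.indicator fun ζ : ℂ => ‖ζ⁻¹‖ₑ) := hm.indicator hS
    refine (ENNReal.lintegral_mul_le_Lp_mul_Lq volume hps ha
      (hk.comp (measurable_const.sub measurable_id)).aemeasurable).trans_eq ?_
    congr 2
    rw [← lintegral_indicator hS]
    have h1 := lintegral_sub_left_eq_self (μ := (volume : Measure ℂ))
      (fun ζ => S.indicator (fun ζ : ℂ => ‖ζ⁻¹‖ₑ) ζ ^ s) z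
    refine h1.trans (lintegral_congr fun ζ => ?_)
    by_cases hζ : ζ ∈ S
    · simp [hζ]
    · simp [hζ, hps.symm.pos]
  have hF : I ^ (1 / r) ≠ ⊤ := (ENNReal.rpow_lt_top_of_nonneg (by positivity) hI.ne).ne
  have hF' : I' ^ (1 / r') ≠ ⊤ := (ENNReal.rpow_lt_top_of_nonneg (by positivity) hI'.ne).ne
  refine ⟨(I ^ (1 / r) + I' ^ (1 / r')).toNNReal, fun a ha z => ?_⟩
  rw [ENNReal.coe_toNNReal (ENNReal.add_ne_top.2 ⟨hF, hF'⟩)]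
  have hsplit : ∀ ζ, a ζ * ‖(z - ζ)⁻¹‖ₑ =
      a ζ * (Metric.ball (0 : ℂ) 1).indicator (fun ζ => ‖ζ⁻¹‖ₑ) (z - ζ) +
      a ζ * (Metric.ball (0 : ℂ) 1)ᶜ.indicator (fun ζ => ‖ζ⁻¹‖ₑ) (z - ζ) := fun ζ => by
    rw [← mul_add, Set.indicator_self_add_compl_apply]
  have hmz : Measurable fun ζ => (Metric.ball (0 : ℂ) 1).indicator (fun ζ => ‖ζ⁻¹‖ₑ) (z - ζ) :=
    (hm.indicator hball).comp (measurable_const.sub measurable_id)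
  rw [lintegral_congr hsplit, lintegral_add_left' (ha.fun_mul hmz.aemeasurable)]
  refine (add_le_add (holder hc hball a ha z) (holder hc' hball.compl a ha z)).trans ?_
  rw [mul_comm _ (_ ^ (1 / r)), mul_comm _ (_ ^ (1 / r')), mul_add]
  gcongr
  · exact le_self_add
  · exact le_add_self

-- Continuity from above of the finite measure with density b along sets decreasing to ∅.
open Filter Topology in
theorem tendsto_setLIntegral_compl_closedBall {b : ℂ → ℝ≥0∞} (hb : ∫⁻ ζ, b ζ ≠ ⊤) :
    Tendsto (fun n : ℕ => ∫⁻ ζ in (Metric.closedBall (0 : ℂ) n)ᶜ, b ζ) atTop (𝓝 0) := by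
  have hS : ∀ n : ℕ, MeasurableSet (Metric.closedBall (0 : ℂ) n)ᶜ :=
    fun n => Metric.isClosed_closedBall.measurableSet.compl
  have h1 := tendsto_measure_iInter_atTop (μ := (volume : Measure ℂ).withDensity b)
    (s := fun n : ℕ => (Metric.closedBall (0 : ℂ) n)ᶜ) (fun n => (hS n).nullMeasurableSet)
    (fun m n hmn => Set.compl_subset_compl.2 (Metric.closedBall_subset_closedBall
      (by exact_mod_cast hmn))) ⟨0, by
        rw [withDensity_apply _ (hS 0)]
        exact ((setLIntegral_le_lintegral _ _).trans_lt hb.lt_top).ne⟩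
  have h2 : ⋂ n : ℕ, (Metric.closedBall (0 : ℂ) n)ᶜ = ∅ := by
    rw [← Set.compl_iUnion, Metric.iUnion_closedBall_nat, Set.compl_univ]
  rw [h2, measure_empty] at h1
  exact h1.congr fun n => withDensity_apply _ (hS n)

open Filter Topology in
/-- The convolution of the Cauchy kernel with a function in `L^q ∩ L^q'` vanishes at infinity. -/
theorem tendsto_lintegral_cauchyKernel {q q' : ℝ} (hq : 2 < q) (hq'1 : 1 < q') (hq' : q' < 2)
    {a : ℂ → ℝ≥0∞} (ha : AEMeasurable a) (haq : ∫⁻ ζ, a ζ ^ q ≠ ⊤) (haq' : ∫⁻ ζ, a ζ ^ q' ≠ ⊤) :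
    Tendsto (fun z => ∫⁻ ζ, a ζ * ‖(z - ζ)⁻¹‖ₑ) (cocompact ℂ) (𝓝 0) := by
  obtain ⟨K, hK⟩ := exists_lintegral_cauchyKernel_le hq hq'1 hq'
  let S : ℕ → Set ℂ := fun n => Metric.closedBall 0 n
  have hS : ∀ n, MeasurableSet (S n) := fun n => Metric.isClosed_closedBall.measurableSet
  have hpow : ∀ {p : ℝ}, 1 < p → ∀ n ζ, (S n)ᶜ.indicator a ζ ^ p =
      (S n)ᶜ.indicator (fun ζ => a ζ ^ p) ζ := by
    intro p hp n ζ
    by_cases hζ : ζ ∈ (S n)ᶜ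
    · rw [Set.indicator_of_mem hζ, Set.indicator_of_mem hζ]
    · rw [Set.indicator_of_notMem hζ, Set.indicator_of_notMem hζ, ENNReal.zero_rpow_of_pos (by linarith)]
  have htail : ∀ {p : ℝ}, 1 < p → ∫⁻ ζ, a ζ ^ p ≠ ⊤ →
      Tendsto (fun n => (∫⁻ ζ, (S n)ᶜ.indicator a ζ ^ p) ^ (1 / p)) atTop (𝓝 0) := by
    intro p hp h
    have h1 := (ENNReal.continuous_rpow_const (y := 1 / p)).tendsto 0 |>.comp
      (tendsto_setLIntegral_compl_closedBall h)
    rw [ENNReal.zero_rpow_of_pos (by positivity)] at h1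
    refine h1.congr fun n => ?_
    simp only [Function.comp, hpow hp, lintegral_indicator (hS n).compl]
    rfl
  have htl : Tendsto (fun n => (K : ℝ≥0∞) * ((∫⁻ ζ, (S n)ᶜ.indicator a ζ ^ q) ^ (1 / q) +
      (∫⁻ ζ, (S n)ᶜ.indicator a ζ ^ q') ^ (1 / q'))) atTop (𝓝 0) := by
    have := ENNReal.Tendsto.const_mul (a := (K : ℝ≥0∞))
      ((htail (by linarith) haq).add (htail hq'1 haq')) (Or.inr ENNReal.coe_ne_top)
    simpa using this
  rw [ENNReal.tendsto_nhds_zero]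
  intro ε hε
  -- Cut a at a ball of radius n. The outer part contributes at most ε/2 uniformly in z by the
  -- kernel bound; the inner part has finite mass c, since a ≤ 1 + a^q, and contributes at most
  -- c/(|z| - n).
  have hε2 : 0 < ε / 2 := ENNReal.half_pos hε.ne'
  obtain ⟨n, hn⟩ := (ENNReal.tendsto_nhds_zero.1 htl (ε / 2) hε2).exists
  have hc : ∫⁻ ζ in S n, a ζ ≠ ⊤ := by
    refine ((lintegral_mono (g := fun ζ => 1 + a ζ ^ q) fun ζ => ?_).trans_lt ?_).ne
    · rcases le_total (a ζ) 1 with h | h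
      · exact h.trans le_self_add
      · refine le_trans ?_ le_add_self
        simpa using ENNReal.rpow_le_rpow_of_exponent_le h (by linarith : (1 : ℝ) ≤ q)
    · rw [lintegral_add_left measurable_const]
      refine ENNReal.add_lt_top.2 ⟨?_, (setLIntegral_le_lintegral _ _).trans_lt haq.lt_top⟩
      rw [setLIntegral_one]
      exact measure_closedBall_lt_top
  set c := ∫⁻ ζ in S n, a ζ
  have hlim : Tendsto (fun z : ℂ => c * ENNReal.ofReal (‖z‖ - n)⁻¹) (cocompact ℂ) (𝓝 0) := by
    have h1 : Tendsto (fun z : ℂ => (‖z‖ - n)⁻¹) (cocompact ℂ) (𝓝 0) :=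
      tendsto_inv_atTop_zero.comp
        (tendsto_atTop_add_const_right _ (-(n : ℝ)) (tendsto_norm_cocompact_atTop (E := ℂ)))
    have h2 := ENNReal.Tendsto.const_mul (a := c) (ENNReal.tendsto_ofReal h1) (Or.inr hc)
    simpa using h2
  filter_upwards [ENNReal.tendsto_nhds_zero.1 hlim (ε / 2) hε2,
    (tendsto_norm_cocompact_atTop (E := ℂ)).eventually_gt_atTop (n : ℝ)] with z hz hzn
  have hsplit : ∀ ζ, a ζ * ‖(z - ζ)⁻¹‖ₑ = (S n).indicator (fun ζ => a ζ * ‖(z - ζ)⁻¹‖ₑ) ζ +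
      (S n)ᶜ.indicator a ζ * ‖(z - ζ)⁻¹‖ₑ := fun ζ => by
    by_cases hζ : ζ ∈ S n <;> simp [hζ]
  have hm : Measurable fun ζ : ℂ => ‖(z - ζ)⁻¹‖ₑ := (measurable_const.sub measurable_id).inv.enorm
  rw [lintegral_congr hsplit, lintegral_add_left' ((ha.fun_mul hm.aemeasurable).indicator (hS n)), lintegral_indicator (hS n),
    ← ENNReal.add_halves ε]
  refine add_le_add (le_trans ?_ hz) ((hK _ (ha.indicator (hS n).compl) z).trans hn)
  rw [← lintegral_mul_const' _ _ ENNReal.ofReal_ne_top]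
  refine setLIntegral_mono' (hS n) fun ζ hζ => ?_
  gcongr
  rw [← ofReal_norm, norm_inv]
  apply ENNReal.ofReal_le_ofReal
  have hζ' : ‖ζ‖ ≤ n := by simpa [S] using hζ
  have : ‖z‖ - ‖ζ‖ ≤ ‖z - ζ‖ := norm_sub_norm_le _ _
  exact inv_anti₀ (by linarith) (by linarith)

/-- Interpolation: the `L^q` norm is bounded in terms of the `L^p` and `L^p'` norms. -/
theorem exists_lintegral_rpow_le {p p' : ℝ≥0∞} (hp' : 0 < p') {q : ℝ} (hq0 : 0 < q)
    (hqp' : p' ≤ ENNReal.ofReal q) (hqp : ENNReal.ofReal q ≤ p) (s : ℝ≥0) :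
    ∃ D : ℝ≥0, ∀ A : ℂ → ℝ, AEStronglyMeasurable A → eLpNorm A p volume ≤ s → eLpNorm A p' volume ≤ s →
      ∫⁻ z, ‖A z‖ₑ ^ q ≤ D := by
  have hp't : p' ≠ ⊤ := (hqp'.trans_lt ENNReal.ofReal_lt_top).ne
  have hpow : ∀ {r : ℝ≥0∞}, r ≠ 0 → r ≠ ⊤ → ∀ A : ℂ → ℝ, eLpNorm A r volume ≤ s →
      ∫⁻ z, ‖A z‖ₑ ^ r.toReal ≤ (s : ℝ≥0∞) ^ r.toReal := by
    intro r h0 ht A hA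
    rw [eLpNorm_eq_lintegral_rpow_enorm_toReal h0 ht] at hA
    have := ENNReal.rpow_le_rpow hA (ENNReal.toReal_nonneg (a := r))
    rwa [← ENNReal.rpow_mul, one_div_mul_cancel (ENNReal.toReal_pos h0 ht).ne',
      ENNReal.rpow_one] at this
  have hfin : ∀ r : ℝ, 0 ≤ r → (s : ℝ≥0∞) ^ r ≠ ⊤ :=
    fun r hr => (ENNReal.rpow_lt_top_of_nonneg hr ENNReal.coe_ne_top).ne
  have hqp'r : p'.toReal ≤ q := by
    have := ENNReal.toReal_mono ENNReal.ofReal_ne_top hqp'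
    rwa [ENNReal.toReal_ofReal hq0.le] at this
  -- For p = ∞ use |A|^q ≤ s^(q - p') |A|^p'; for finite p use |A|^q ≤ |A|^p + |A|^p', according to
  -- whether |A| exceeds 1.
  by_cases hpt : p = ⊤
  · subst hpt
    have hF : (s : ℝ≥0∞) ^ (q - p'.toReal) * (s : ℝ≥0∞) ^ p'.toReal ≠ ⊤ :=
      ENNReal.mul_ne_top (hfin _ (by linarith)) (hfin _ ENNReal.toReal_nonneg)
    refine ⟨((s : ℝ≥0∞) ^ (q - p'.toReal) * (s : ℝ≥0∞) ^ p'.toReal).toNNReal,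
      fun A hAm hA hA' => ?_⟩
    rw [ENNReal.coe_toNNReal hF]
    refine le_trans ?_ (mul_le_mul_right (hpow hp'.ne' hp't A hA') _)
    rw [← lintegral_const_mul' _ _ (hfin _ (by linarith))]
    rw [eLpNorm_exponent_top] at hA
    refine lintegral_mono_ae ?_
    filter_upwards [ae_le_eLpNormEssSup (f := A) (μ := volume)] with z hz
    calc ‖A z‖ₑ ^ q = ‖A z‖ₑ ^ (q - p'.toReal) * ‖A z‖ₑ ^ p'.toReal := by
          rw [← ENNReal.rpow_add_of_nonneg _ _ (by linarith) ENNReal.toReal_nonneg, sub_add_cancel]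
      _ ≤ _ := by
          refine mul_le_mul_left (ENNReal.rpow_le_rpow ?_ (by linarith)) _
          exact hz.trans hA
  · have hp0 : p ≠ 0 := ((hp'.trans_le hqp').trans_le hqp).ne'
    have hqpr : q ≤ p.toReal := by
      have := ENNReal.toReal_mono hpt hqp
      rwa [ENNReal.toReal_ofReal hq0.le] at this
    have hF : (s : ℝ≥0∞) ^ p.toReal + (s : ℝ≥0∞) ^ p'.toReal ≠ ⊤ :=
      ENNReal.add_ne_top.2 ⟨hfin _ ENNReal.toReal_nonneg, hfin _ ENNReal.toReal_nonneg⟩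
    refine ⟨((s : ℝ≥0∞) ^ p.toReal + (s : ℝ≥0∞) ^ p'.toReal).toNNReal, fun A hAm hA hA' => ?_⟩
    rw [ENNReal.coe_toNNReal hF]
    refine le_trans ?_ (add_le_add (hpow hp0 hpt A hA) (hpow hp'.ne' hp't A hA'))
    rw [← lintegral_add_left' (hAm.enorm.pow_const _)]
    refine lintegral_mono fun z => ?_
    rcases le_total ‖A z‖ₑ 1 with h | h
    · exact (ENNReal.rpow_le_rpow_of_exponent_ge h hqp'r).trans le_add_self
    · exact (ENNReal.rpow_le_rpow_of_exponent_le h hqpr).trans le_self_add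

/-! ### The chain rule for log L -/

open Convolution ContinuousLinearMap in
/-- Mollification is symmetric for the pairing with bounded functions of compact support. -/
theorem integral_normed_convolution_mul (ρ : ContDiffBump (0 : ℂ)) {h ψ : ℂ → ℂ}
    (hh : LocallyIntegrable h) (hψ : AEStronglyMeasurable ψ) {C : ℝ} (hC : ∀ z, ‖ψ z‖ ≤ C)
    {K : Set ℂ} (hK : IsCompact K) (hψK : ∀ z ∉ K, ψ z = 0) :
    ∫ z, (ρ.normed volume ⋆[lsmul ℝ ℝ] h) z * ψ z =
      ∫ z, h z * (ρ.normed volume ⋆[lsmul ℝ ℝ] ψ) z := by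
  let r : ℂ → ℝ := ρ.normed volume
  have hr : Continuous r := ρ.continuous_normed
  have hrs : HasCompactSupport r := ρ.hasCompactSupport_normed
  obtain ⟨c, hc⟩ := hr.bounded_above_of_compact_support hrs
  -- For x in K only values of h on this compact set enter the double integral, so h may be replaced
  -- there by an integrable function.
  let S := Metric.cthickening ρ.rOut K
  have hS : IsCompact S := hK.cthickening
  have hψi : Integrable ψ := by
    have : IntegrableOn ψ K := Measure.integrableOn_of_bounded hK.measure_lt_top.ne hψ
      (Filter.Eventually.of_forall hC)
    exact (integrableOn_iff_integrable_of_support_subset fun z hz => by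
      by_contra h
      exact hz (hψK z h)).1 this
  have hhi : Integrable (S.indicator h) :=
    (integrable_indicator_iff hS.measurableSet).2 (hh.integrableOn_isCompact hS)
  have hI : Integrable (fun p : ℂ × ℂ => r (p.1 - p.2) • h p.2 * ψ p.1)
      ((volume : Measure ℂ).prod volume) := by
    have h1 : Integrable (fun p : ℂ × ℂ => ψ p.1 * S.indicator h p.2)
      ((volume : Measure ℂ).prod volume) := hψi.mul_prod hhi
    have h2 : Integrable (fun p : ℂ × ℂ => ((r (p.1 - p.2) : ℝ) : ℂ) * (ψ p.1 * S.indicator h p.2))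
        ((volume : Measure ℂ).prod volume) := by
      refine h1.bdd_mul (c := c) ?_ (Filter.Eventually.of_forall fun p => ?_)
      · exact (Complex.continuous_ofReal.comp (hr.comp
          (continuous_fst.sub continuous_snd))).aestronglyMeasurable
      · rw [Complex.norm_real]
        exact hc _
    refine h2.congr (Filter.Eventually.of_forall ?_)
    rintro ⟨x, t⟩
    simp only [Complex.real_smul]
    by_cases ht : t ∈ S
    · rw [Set.indicator_of_mem ht]
      ring
    · by_cases hx : x ∈ K
      · have : r (x - t) = 0 := by
          by_contra hne
          have hmem : x - t ∈ Function.support (ρ.normed volume) := hne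
          rw [ρ.support_normed_eq, mem_ball_zero_iff, ← dist_eq_norm, dist_comm] at hmem
          exact ht (Metric.mem_cthickening_of_dist_le t x _ _ hx hmem.le)
        simp [this]
      · simp [hψK x hx]
  calc ∫ z, (ρ.normed volume ⋆[lsmul ℝ ℝ] h) z * ψ z
      = ∫ x, ∫ t, r (x - t) • h t * ψ x := by
        refine integral_congr_ae (Filter.Eventually.of_forall fun x => ?_)
        simp only [convolution_eq_swap, lsmul_apply, integral_mul_const]
        rfl
    _ = ∫ t, ∫ x, r (x - t) • h t * ψ x := integral_integral_swap hI
    _ = _ := by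
        refine integral_congr_ae (Filter.Eventually.of_forall fun t => ?_)
        simp only [convolution_eq_swap, lsmul_apply]
        rw [← integral_const_mul]
        refine integral_congr_ae (Filter.Eventually.of_forall fun x => ?_)
        have : r (x - t) = r (t - x) := by
          rw [← neg_sub t x]
          exact ρ.normed_neg (t - x)
        simp only [this, Complex.real_smul]
        change _ = h t * ((r (t - x) : ℝ) * ψ x)
        ring

theorem hasFDerivAt_clog_real {f : ℂ → ℂ} {f' : ℂ →L[ℝ] ℂ} {x : ℂ} (hf : HasFDerivAt f f' x)
    (h : f x ∈ Complex.slitPlane) :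
    HasFDerivAt (fun z => Complex.log (f z)) ((f x)⁻¹ • f') x := by
  have h1 := ((Complex.hasStrictDerivAt_log h).hasDerivAt.hasFDerivAt.restrictScalars ℝ).comp x hf
  refine h1.congr_fderiv ?_
  ext v
  simp [mul_comm]

open Filter Topology in
/-- Perturbing `f` to `g`, the function `L - log (g / f)` is a branch of `log (M / g)`; this is the
derivative of its logarithm. -/
theorem hasFDerivAt_log_sub_log_div {f g L : ℂ → ℂ} {M : ℂ} (hM : M ≠ 0) (hf : Continuous f)
    (hf0 : ∀ z, f z ≠ 0) (hL : IsContinuousLog L fun z => M / f z) {x : ℂ}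
    {g' : ℂ →L[ℝ] ℂ} (hg : HasFDerivAt g g' x) (h1 : g x / f x ∈ Complex.slitPlane)
    (h2 : L x - Complex.log (g x / f x) ∈ Complex.slitPlane) :
    HasFDerivAt (fun z => Complex.log (L z - Complex.log (g z / f z)))
      (-(g x * (L x - Complex.log (g x / f x)))⁻¹ • g') x := by
  set l : ℂ → ℂ := fun z => L z - Complex.log (g z / f z) with hl
  have hgx : g x ≠ 0 := fun h => by simp [h] at h1
  have hq : ContinuousAt (fun z => g z / f z) x := hg.continuousAt.div hf.continuousAt (hf0 x)
  have hlc : ContinuousAt l x := hL.1.continuousAt.sub (hq.clog h1)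
  have hexp : ∀ᶠ z in 𝓝 x, g z = M * Complex.exp (-l z) := by
    filter_upwards [hg.continuousAt.eventually_ne hgx] with z hz
    have h3 : Complex.exp (L z) = M / f z := hL.2 z
    rw [hl]
    simp only [neg_sub]
    rw [Complex.exp_sub, Complex.exp_log (div_ne_zero hz (hf0 z)), h3]
    have := hf0 z
    field_simp
  have hgx' := hexp.self_of_nhds
  -- Neither L nor f is differentiable, but near x the branch l equals an expression in g alone.
  -- Continuity keeps the imaginary part of l x - l z in (-π, π), so the principal logarithm
  -- recovers it.
  have heq : (fun z => l x - Complex.log (g z / g x)) =ᶠ[𝓝 x] l := by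
    have h4 : ContinuousAt (fun z => (l x - l z).im) x :=
      Complex.continuous_im.continuousAt.comp (continuousAt_const.sub hlc)
    have h5 : (l x - l x).im ∈ Set.Ioo (-Real.pi) Real.pi := by
      simp [Real.pi_pos]
    filter_upwards [hexp, h4.eventually (isOpen_Ioo.mem_nhds h5)] with z hz hz'
    have h6 : g z / g x = Complex.exp (l x - l z) := by
      rw [hz, hgx', mul_div_mul_left _ _ hM, ← Complex.exp_sub]
      congr 1
      ring
    rw [h6, Complex.log_exp hz'.1 hz'.2.le]
    ring
  have hd1 : HasFDerivAt (fun z => g z / g x) ((g x)⁻¹ • g') x := by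
    simp only [div_eq_mul_inv]
    exact hg.mul_const (g x)⁻¹
  have hd2 : HasFDerivAt (fun z => l x - Complex.log (g z / g x)) (-((g x)⁻¹ • g')) x := by
    have := (hasFDerivAt_clog_real hd1 (by simp [hgx])).const_sub (l x)
    simpa [hgx] using this
  have hd3 := hasFDerivAt_clog_real (hd2.congr_of_eventuallyEq heq.symm) h2
  refine hd3.congr_fderiv ?_
  ext v
  simp only [hl, mul_inv, smul_neg, neg_apply, smul_apply, smul_eq_mul]
  ring

open Filter Topology Convolution ContinuousLinearMap in
/-- The chain rule for `log L`, `L = log (M / f)`: its weak `∂/∂z̄` derivative is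
`-f_z̄ / (f L)`. -/
theorem integral_log_mul_dbar {f h L : ℂ → ℂ} {M : ℂ} (hM : M ≠ 0) (hf : Continuous f)
    (hf0 : ∀ z, f z ≠ 0) (hfh : HasWeakDbar f h) (hL : IsContinuousLog L fun z => M / f z)
    (hL0 : ∀ z, L z ∈ Complex.slitPlane) {φ : ℂ → ℂ} (hφ : ContDiff ℝ 1 φ)
    (hc : HasCompactSupport φ) :
    ∫ z, Complex.log (L z) * dbar φ z = ∫ z, h z * (φ z / (f z * L z)) := by
  let ρ := fun n => (shrinkingBump n).normed (volume : Measure ℂ)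
  have hcs : ∀ n, HasCompactSupport (ρ n) := fun n => (shrinkingBump n).hasCompactSupport_normed
  have hsm : ∀ n, ContDiff ℝ 1 (ρ n) := fun n => (shrinkingBump n).contDiff_normed
  let F : ℕ → ℂ → ℂ := fun n => ρ n ⋆[lsmul ℝ ℝ] f
  have hF : ∀ n, ContDiff ℝ 1 (F n) := fun n =>
    (hcs n).contDiff_convolution_left (lsmul ℝ ℝ : ℝ →L[ℝ] ℂ →L[ℝ] ℂ) (hsm n) hfh.1
  -- A branch of log (M/F n) wherever F n / f lies in the slit plane, which holds on the support of
  -- φ for large n; elsewhere its values are irrelevant.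
  let l : ℕ → ℂ → ℂ := fun n z => L z - Complex.log (F n z / f z)
  let W : ℕ → ℂ → ℂ := fun n z => Complex.log (l n z)
  let ψ : ℕ → ℂ → ℂ := fun n z => φ z / (F n z * l n z)
  let ψ' : ℂ → ℂ := fun z => φ z / (f z * L z)
  have hLne : ∀ z, L z ≠ 0 := fun z => Complex.slitPlane_ne_zero (hL0 z)
  have hψ' : Continuous ψ' := hφ.continuous.div (hf.mul hL.1) fun z => mul_ne_zero (hf0 z) (hLne z)
  have hFm : ∀ n, Measurable (F n) := fun n => (hF n).continuous.measurable
  have hlm : ∀ n, Measurable (l n) := fun n => hL.1.measurable.sub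
    (Complex.measurable_log.comp ((hFm n).div hf.measurable))
  have hWm : ∀ n, Measurable (W n) := fun n => Complex.measurable_log.comp (hlm n)
  have hψm : ∀ n, Measurable (ψ n) := fun n => hφ.continuous.measurable.div ((hFm n).mul (hlm n))
  -- Convergence along `atTop ×ˢ 𝓝 x` is locally uniform enough to give bounds on compact sets, and
  -- it also yields the limit of ρ n ⋆ ψ n, where the mollified function varies with n.
  have snd_tendsto : ∀ {g : ℂ → ℂ}, Continuous g → ∀ x,
      Tendsto (fun q : ℕ × ℂ => g q.2) (atTop ×ˢ 𝓝 x) (𝓝 (g x)) :=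
    fun hg x => (hg.tendsto x).comp tendsto_snd
  have hFt : ∀ x, Tendsto (fun q : ℕ × ℂ => F q.1 q.2) (atTop ×ˢ 𝓝 x) (𝓝 (f x)) := by
    intro x
    exact ContDiffBump.convolution_tendsto_right (μ := (volume : Measure ℂ))
      (φ := fun q : ℕ × ℂ => shrinkingBump q.1)
      (g := fun _ => f) (k := fun q => q.2) (tendsto_rOut_shrinkingBump.comp tendsto_fst)
      (Eventually.of_forall fun _ => hf.aestronglyMeasurable)
      ((hf.tendsto x).comp tendsto_snd) tendsto_snd
  have hqt : ∀ x, Tendsto (fun q : ℕ × ℂ => F q.1 q.2 / f q.2) (atTop ×ˢ 𝓝 x) (𝓝 1) := by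
    intro x
    have := (hFt x).div (snd_tendsto hf x) (hf0 x)
    rwa [div_self (hf0 x)] at this
  have hlt : ∀ x, Tendsto (fun q : ℕ × ℂ => l q.1 q.2) (atTop ×ˢ 𝓝 x) (𝓝 (L x)) := by
    intro x
    have := (snd_tendsto hL.1 x).sub ((hqt x).clog Complex.one_mem_slitPlane)
    rwa [Complex.log_one, sub_zero] at this
  have hWt : ∀ x, Tendsto (fun q : ℕ × ℂ => W q.1 q.2) (atTop ×ˢ 𝓝 x) (𝓝 (Complex.log (L x))) :=
    fun x => (hlt x).clog (hL0 x)
  have hψt : ∀ x, Tendsto (fun q : ℕ × ℂ => ψ q.1 q.2) (atTop ×ˢ 𝓝 x) (𝓝 (ψ' x)) := fun x =>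
    (snd_tendsto hφ.continuous x).div ((hFt x).mul (hlt x)) (mul_ne_zero (hf0 x) (hLne x))
  set K := tsupport φ with hKdef
  have hK : IsCompact K := hc
  have hlog : Continuous fun z => Complex.log (L z) := hL.1.clog hL0
  have on_K : ∀ {P : ℕ → ℂ → Prop}, (∀ x ∈ K, ∀ᶠ q : ℕ × ℂ in atTop ×ˢ 𝓝 x, P q.1 q.2) →
      ∀ᶠ n in atTop, ∀ x ∈ K, P n x := by
    intro P hP
    have h1 : ∀ᶠ q : ℕ × ℂ in atTop ×ˢ 𝓝ˢ K, P q.1 q.2 := hK.mem_prod_nhdsSet_of_forall hP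
    filter_upwards [h1.curry] with n hn
    exact hn.self_of_nhdsSet
  have close_on_K : ∀ {G : ℕ → ℂ → ℂ} {g : ℂ → ℂ}, Continuous g →
      (∀ x, Tendsto (fun q : ℕ × ℂ => G q.1 q.2) (atTop ×ˢ 𝓝 x) (𝓝 (g x))) →
      ∃ C : ℝ, ∀ᶠ n in atTop, ∀ x ∈ K, ‖G n x‖ ≤ C := by
    intro G g hg hG
    obtain ⟨C, hC⟩ := hK.exists_bound_of_continuousOn hg.continuousOn
    refine ⟨C + 1, ?_⟩
    have : ∀ᶠ n in atTop, ∀ x ∈ K, ‖G n x - g x‖ < 1 := on_K fun x _ => by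
      have h1 := ((hG x).sub (snd_tendsto hg x)).norm
      rw [sub_self, norm_zero] at h1
      exact h1.eventually (gt_mem_nhds one_pos)
    filter_upwards [this] with n hn x hx
    have := norm_le_norm_add_norm_sub' (G n x) (g x)
    linarith [hn x hx, hC x hx]
  obtain ⟨CW, hCW⟩ := close_on_K hlog hWt
  obtain ⟨Cψ, hCψ⟩ := close_on_K hψ' hψt
  have hgood1 : ∀ᶠ n in atTop, ∀ x ∈ K, F n x / f x ∈ Complex.slitPlane := on_K fun x _ =>
    (hqt x).eventually (Complex.isOpen_slitPlane.mem_nhds Complex.one_mem_slitPlane)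
  have hgood2 : ∀ᶠ n in atTop, ∀ x ∈ K, l n x ∈ Complex.slitPlane := on_K fun x _ =>
    (hlt x).eventually (Complex.isOpen_slitPlane.mem_nhds (hL0 x))
  have point : ∀ {G : ℕ → ℂ → ℂ} {c : ℂ} {x : ℂ},
      Tendsto (fun q : ℕ × ℂ => G q.1 q.2) (atTop ×ˢ 𝓝 x) (𝓝 c) →
      Tendsto (fun n => G n x) atTop (𝓝 c) := fun hG =>
    hG.comp (tendsto_id.prodMk tendsto_const_nhds)
  have hdz : ∀ x ∉ K, dbar φ x = 0 := fun x hx => dbar_eq_zero_of_notMem_tsupport hx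
  have hdc := continuous_dbar hφ
  have hdi := integrable_dbar hφ hc
  have hlim1 : Tendsto (fun n => ∫ z, W n z * dbar φ z) atTop
      (𝓝 (∫ z, Complex.log (L z) * dbar φ z)) := by
    refine tendsto_integral_filter_of_dominated_convergence (fun z => CW * ‖dbar φ z‖)
      (Eventually.of_forall fun n => ((hWm n).mul hdc.measurable).aestronglyMeasurable) ?_
      (hdi.norm.const_mul _) (Eventually.of_forall fun x => (point (hWt x)).mul_const _)
    filter_upwards [hCW] with n hn
    refine Eventually.of_forall fun x => ?_
    rw [norm_mul]
    by_cases hx : x ∈ K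
    · exact mul_le_mul_of_nonneg_right (hn x hx) (norm_nonneg _)
    · simp [hdz x hx]
  have hψz : ∀ n, ∀ x ∉ K, ψ n x = 0 := fun n x hx => by
    simp [ψ, image_eq_zero_of_notMem_tsupport hx]
  have hψbound : ∀ᶠ n in atTop, ∀ x, ‖ψ n x‖ ≤ |Cψ| := by
    filter_upwards [hCψ] with n hn x
    by_cases hx : x ∈ K
    · exact (hn x hx).trans (le_abs_self _)
    · simp [hψz n x hx]
  -- The bumps have radius at most 1, so this contains the supports of all ρ n ⋆ ψ n.
  let K' := Metric.cthickening 1 K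
  have hK' : IsCompact K' := hK.cthickening
  have hlim2 : Tendsto (fun n => ∫ z, h z * (ρ n ⋆[lsmul ℝ ℝ] ψ n) z) atTop
      (𝓝 (∫ z, h z * ψ' z)) := by
    refine tendsto_integral_filter_of_dominated_convergence
      (fun z => K'.indicator (fun z => ‖h z‖ * |Cψ|) z) ?_ ?_ ?_ ?_
    · filter_upwards [hψbound] with n hn
      have hloc : LocallyIntegrable (ψ n) := by
        rw [locallyIntegrable_iff]
        exact fun K hK => Measure.integrableOn_of_bounded hK.measure_lt_top.ne
          (hψm n).aestronglyMeasurable (Eventually.of_forall hn)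
      exact hfh.2.1.aestronglyMeasurable.mul
        ((hcs n).continuous_convolution_left (lsmul ℝ ℝ : ℝ →L[ℝ] ℂ →L[ℝ] ℂ)
          (hsm n).continuous hloc).aestronglyMeasurable
    · filter_upwards [hψbound] with n hn
      refine Eventually.of_forall fun x => ?_
      rw [norm_mul]
      by_cases hx : x ∈ K'
      · rw [Set.indicator_of_mem hx]
        gcongr
        exact norm_normed_convolution_le (hψm n).aestronglyMeasurable fun y _ => hn y
      · rw [Set.indicator_of_notMem hx]
        have : ‖(ρ n ⋆[lsmul ℝ ℝ] ψ n) x‖ ≤ 0 := by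
          refine norm_normed_convolution_le (hψm n).aestronglyMeasurable fun y hy => ?_
          rw [hψz n y, norm_zero]
          intro hyK
          refine hx (Metric.mem_cthickening_of_dist_le x y _ _ hyK ?_)
          rw [dist_comm]
          exact (Metric.mem_ball.1 hy).le.trans (rOut_shrinkingBump_le_one n)
        nlinarith [norm_nonneg (h x), norm_nonneg ((ρ n ⋆[lsmul ℝ ℝ] ψ n) x)]
    · exact (integrable_indicator_iff hK'.measurableSet).2
        ((hfh.2.1.integrableOn_isCompact hK').norm.mul_const _)
    · refine Eventually.of_forall fun x => Tendsto.const_mul _ ?_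
      exact ContDiffBump.convolution_tendsto_right (μ := (volume : Measure ℂ))
        tendsto_rOut_shrinkingBump (Eventually.of_forall fun n => (hψm n).aestronglyMeasurable)
        (hψt x) tendsto_const_nhds
  refine tendsto_nhds_unique (hlim1.congr' ?_) hlim2
  filter_upwards [hψbound, hgood1, hgood2] with n hnψ hn1 hn2
  -- For large n the two sequences agree exactly: moving the mollifier onto h produces the classical
  -- ∂/∂z̄ of F n, and integration by parts does the rest.
  rw [← integral_normed_convolution_mul (shrinkingBump n) hfh.2.1 (hψm n).aestronglyMeasurable
    hnψ hK (hψz n)]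
  have hFd : ∀ x, HasFDerivAt (F n) (fderiv ℝ (F n) x) x := fun x =>
    ((hF n).differentiable one_ne_zero x).hasFDerivAt
  have hWd : ∀ x ∈ K, HasFDerivAt (W n) (-(F n x * l n x)⁻¹ • fderiv ℝ (F n) x) x := fun x hx =>
    hasFDerivAt_log_sub_log_div hM hf hf0 hL (hFd x) (hn1 x hx) (hn2 x hx)
  have hFne : ∀ x ∈ K, F n x ≠ 0 := fun x hx h => by
    have := hn1 x hx
    simp [h] at this
  have hlc : ContinuousOn (l n) K := fun x hx =>
    (hL.1.continuousAt.sub (((hF n).continuous.continuousAt.div hf.continuousAt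
      (hf0 x)).clog (hn1 x hx))).continuousWithinAt
  have onK_integrable : ∀ {g : ℂ → ℂ}, ContinuousOn g K → (∀ x ∉ K, g x = 0) → Integrable g := by
    intro g hg hgz
    refine (integrableOn_iff_integrable_of_support_subset fun z hz => ?_).1
      (hg.integrableOn_compact hK)
    by_contra h
    exact hz (hgz z h)
  have hWc : ContinuousOn (W n) K := fun x hx => (hWd x hx).continuousAt.continuousWithinAt
  have hdφ : ∀ v, Continuous fun x => fderiv ℝ φ x v := fun v =>
    (hφ.continuous_fderiv one_ne_zero).clm_apply continuous_const
  have hφz : ∀ v, ∀ x ∉ K, fderiv ℝ φ x v = 0 := fun v x hx => by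
    simp [fderiv_eq_zero_of_notMem_tsupport hx]
  have hWfc : ∀ v, ContinuousOn (fun x => fderiv ℝ (W n) x v) K := by
    intro v
    have h1 : ContinuousOn (fun x => -(F n x * l n x)⁻¹ * fderiv ℝ (F n) x v) K :=
      (((hF n).continuous.continuousOn.mul hlc).inv₀ fun x hx =>
        mul_ne_zero (hFne x hx) (Complex.slitPlane_ne_zero (hn2 x hx))).neg.mul
        ((((hF n).continuous_fderiv one_ne_zero).clm_apply continuous_const).continuousOn)
    refine h1.congr fun x hx => ?_
    rw [(hWd x hx).fderiv]
    simp
  have hi1 : ∀ v, Integrable fun x => W n x * fderiv ℝ φ x v := fun v =>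
    onK_integrable (hWc.mul (hdφ v).continuousOn) fun x hx => by rw [hφz v x hx, mul_zero]
  have hi2 : ∀ v, Integrable fun x => fderiv ℝ (W n) x v * φ x := fun v =>
    onK_integrable ((hWfc v).mul hφ.continuous.continuousOn) fun x hx => by
      rw [image_eq_zero_of_notMem_tsupport hx, mul_zero]
  have hi3 : Integrable fun x => W n x * φ x :=
    onK_integrable (hWc.mul hφ.continuous.continuousOn) fun x hx => by
      rw [image_eq_zero_of_notMem_tsupport hx, mul_zero]
  have hparts : ∀ v, ∫ x, W n x * fderiv ℝ φ x v = -∫ x, fderiv ℝ (W n) x v * φ x := fun v =>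
    integral_mul_fderiv_eq_neg_fderiv_mul_of_integrable (hi2 v) (hi1 v) hi3
      (fun x hx => (hWd x hx).differentiableAt)
      (fun x _ => hφ.differentiable one_ne_zero x)
  calc ∫ z, W n z * dbar φ z
      = ((∫ z, W n z * fderiv ℝ φ z 1) + Complex.I * ∫ z, W n z * fderiv ℝ φ z Complex.I) / 2 := by
        rw [← integral_const_mul, ← integral_add (hi1 1) ((hi1 Complex.I).const_mul _),
          ← integral_div]
        refine integral_congr_ae (Eventually.of_forall fun x => ?_)
        simp only [dbar]
        ring
    _ = ∫ z, -(dbar (W n) z * φ z) := by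
        have e : ∫ z, dbar (W n) z * φ z = ((∫ z, fderiv ℝ (W n) z 1 * φ z) +
            Complex.I * ∫ z, fderiv ℝ (W n) z Complex.I * φ z) / 2 := by
          rw [← integral_const_mul, ← integral_add (hi2 1) ((hi2 Complex.I).const_mul _),
            ← integral_div]
          refine integral_congr_ae (Eventually.of_forall fun x => ?_)
          simp only [dbar]
          ring
        rw [hparts, hparts, integral_neg, e]
        ring
    _ = _ := by
        refine integral_congr_ae (Eventually.of_forall fun x => ?_)
        beta_reduce
        by_cases hx : x ∈ K
        · rw [← dbar_normed_convolution hfh, dbar, (hWd x hx).fderiv, dbar]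
          simp only [ψ, F, ρ, smul_apply, smul_eq_mul]
          field_simp
          ring
        · rw [hψz n x hx, image_eq_zero_of_notMem_tsupport hx]
          simp

/-! ### Oscillation of log L and the conclusion -/

theorem enorm_cauchyTransform_le (g : ℂ → ℂ) (z : ℂ) :
    ‖cauchyTransform g z‖ₑ ≤ ∫⁻ ζ, ‖g ζ / (z - ζ)‖ₑ := by
  have hpi : ‖(Real.pi : ℂ)⁻¹‖ ≤ 1 := by
    rw [norm_inv, Complex.norm_real, Real.norm_of_nonneg Real.pi_pos.le]
    exact inv_le_one_of_one_le₀ (by linarith [Real.pi_gt_three])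
  have hpi' : ‖(Real.pi : ℂ)⁻¹‖ₑ ≤ 1 := by
    rw [← ofReal_norm]
    exact ENNReal.ofReal_le_one.2 hpi
  rw [cauchyTransform, enorm_mul]
  exact (mul_le_mul' hpi' (enorm_integral_le_lintegral_enorm _)).trans_eq (one_mul _)

open Filter Topology in
/-- A function on `ℂ` whose oscillation vanishes at infinity has a limit there. -/
theorem exists_tendsto_cocompact {w : ℂ → ℂ}
    (h : ∀ ε > 0, ∃ R : ℝ, ∀ z z', R < ‖z‖ → R < ‖z'‖ → ‖w z - w z'‖ ≤ ε) :
    ∃ c, Tendsto w (cocompact ℂ) (𝓝 c) := by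
  rw [← cauchy_map_iff_exists_tendsto, Metric.cauchy_iff]
  refine ⟨inferInstance, fun ε hε => ?_⟩
  obtain ⟨R, hR⟩ := h (ε / 2) (half_pos hε)
  refine ⟨w '' {z | R < ‖z‖}, image_mem_map
    ((tendsto_norm_cocompact_atTop (E := ℂ)).eventually_gt_atTop R), ?_⟩
  rintro _ ⟨z, hz, rfl⟩ _ ⟨z', hz', rfl⟩
  rw [dist_eq_norm]
  linarith [hR z z' hz hz']

open Filter Topology in
/-- If `w` is continuous with bounded imaginary part and weak `∂/∂z̄` derivative `g`, where the
Cauchy potential of `g` is bounded and vanishes at infinity, then `w` has bounded oscillation and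
a limit at infinity. -/
theorem oscillation_le_of_weakDbar {w g : ℂ → ℂ} {b : ℝ} (hw : Continuous w)
    (hwb : ∀ z, |(w z).im| ≤ b) (hg : AEStronglyMeasurable g) {B : ℝ≥0}
    (hgB : ∀ z, ∫⁻ ζ, ‖g ζ / (z - ζ)‖ₑ ≤ B)
    (hg0 : Tendsto (fun z => ∫⁻ ζ, ‖g ζ / (z - ζ)‖ₑ) (cocompact ℂ) (𝓝 0))
    (hwg : ∀ φ : ℂ → ℂ, ContDiff ℝ ∞ φ → HasCompactSupport φ →
      ∫ z, w z * dbar φ z = -∫ z, g z * φ z) :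
    (∀ z z', ‖w z - w z'‖ ≤ 2 * B) ∧ ∃ c, Tendsto w (cocompact ℂ) (𝓝 c) := by
  set u := cauchyTransform g with hu
  have hum : AEStronglyMeasurable u := aestronglyMeasurable_cauchyTransform hg
  have huB : ∀ z, ‖u z‖ ≤ B := fun z => by
    have h1 := (enorm_cauchyTransform_le g z).trans (hgB z)
    rw [← ofReal_norm] at h1
    exact (ENNReal.ofReal_le_coe).1 h1
  have huL : LocallyIntegrable u := by
    rw [locallyIntegrable_iff]
    exact fun K hK => Measure.integrableOn_of_bounded hK.measure_lt_top.ne hum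
      (Eventually.of_forall huB)
  have h0 : HasWeakDbar (fun z => w z - u z) 0 := by
    refine ⟨hw.locallyIntegrable.sub huL, locallyIntegrable_zero, fun φ hφ hc => ?_⟩
    have hφ1 : ContDiff ℝ 1 φ := hφ.of_le (by exact_mod_cast le_top)
    have h1 : Integrable fun z => w z * dbar φ z :=
      (hw.mul (continuous_dbar hφ1)).integrable_of_hasCompactSupport
        (hasCompactSupport_dbar hc).mul_left
    have h2 : Integrable fun z => u z * dbar φ z :=
      (integrable_dbar hφ1 hc).bdd_mul (c := B) hum (Eventually.of_forall huB)
    simp only [sub_mul]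
    rw [integral_sub h1 h2, hwg φ hφ hc,
      integral_cauchyTransform_mul_dbar hg ENNReal.coe_ne_top hgB hφ1 hc]
    simp
  refine ⟨fun z z' => norm_sub_le_of_hasWeakDbar_zero hw hwb hum huB h0 one_pos
    (fun x _ => huB x) (fun x _ => huB x), exists_tendsto_cocompact fun ε hε => ?_⟩
  have hev := ENNReal.tendsto_nhds_zero.1 hg0 (ENNReal.ofReal (ε / 2)) (by simpa using hε)
  have hev' : ∀ᶠ z in cocompact ℂ, ‖u z‖ ≤ ε / 2 := by
    filter_upwards [hev] with z hz
    have h1 := (enorm_cauchyTransform_le g z).trans hz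
    rw [← ofReal_norm] at h1
    exact (ENNReal.ofReal_le_ofReal_iff (by positivity)).1 h1
  obtain ⟨R, hR⟩ := (Metric.closedBall_compl_subset_of_mem_cocompact hev' 0)
  -- The extra 1 keeps unit balls around z and z' in the region where |u| ≤ ε/2.
  refine ⟨R + 1, fun z z' hz hz' => ?_⟩
  have hball : ∀ y : ℂ, R + 1 < ‖y‖ → ∀ x ∈ Metric.ball y 1, ‖u x‖ ≤ ε / 2 := by
    intro y hy x hx
    apply hR
    rw [Set.mem_compl_iff, mem_closedBall_zero_iff, not_le]
    rw [mem_ball_iff_norm] at hx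
    linarith [norm_sub_norm_le y x, norm_sub_rev x y]
  have := norm_sub_le_of_hasWeakDbar_zero hw hwb hum huB h0 one_pos (hball z hz) (hball z' hz')
  linarith

open Filter Topology in
theorem proposition6 (p p' : ℝ≥0∞) (hp : 2 < p) (hp'0 : 0 < p') (hp' : p' < 2) (s : ℝ≥0) :
    ∃ C : ℝ, 0 < C ∧
      ∀ (f fbar L : ℂ → ℂ) (A : ℂ → ℝ) (M : ℝ),
        Continuous f → (∀ z, f z ≠ 0) → (∀ z, ‖f z‖ < 1) →
        HasWeakDbar f fbar →
        1 ≤ M → IsContinuousLog L (fun z => (M : ℂ) / f z) →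
        MemLp A p volume → MemLp A p' volume →
        eLpNorm A p volume + eLpNorm A p' volume = (s : ℝ≥0∞) →
        (∀ᵐ z ∂(volume : Measure ℂ), ‖fbar z‖ ≤ A z * ‖f z‖ * ‖L z‖) →
        (∃ F : OnePoint ℂ → ℂ, Continuous F ∧ ∀ z : ℂ, F (z : OnePoint ℂ) = f z) ∧
        ∀ z : ℂ, C⁻¹ ≤ ‖L z‖ / ‖L 0‖ ∧ ‖L z‖ / ‖L 0‖ ≤ C := by
  obtain ⟨q, hq, hqp⟩ : ∃ q : ℝ, 2 < q ∧ ENNReal.ofReal q ≤ p := by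
    by_cases hpt : p = ⊤
    · exact ⟨3, by norm_num, by simp [hpt]⟩
    · refine ⟨p.toReal, ?_, (ENNReal.ofReal_toReal hpt).le⟩
      simpa using (ENNReal.toReal_lt_toReal (by simp) hpt).2 hp
  have hp't : p' ≠ ⊤ := (hp'.trans (by simp)).ne
  -- p' may be at most 1, where Hölder is unavailable; raising the exponent to at least 3/2 stays
  -- between p' and 2.
  obtain ⟨q', hq'1, hq', hp'q'⟩ : ∃ q' : ℝ, 1 < q' ∧ q' < 2 ∧ p' ≤ ENNReal.ofReal q' := by
    refine ⟨max p'.toReal (3 / 2), by norm_num, max_lt ?_ (by norm_num), ?_⟩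
    · simpa using (ENNReal.toReal_lt_toReal hp't (by simp)).2 hp'
    · rw [← ENNReal.ofReal_toReal hp't]
      exact ENNReal.ofReal_le_ofReal (by simp)
  have hqq' : ENNReal.ofReal q' ≤ ENNReal.ofReal q := ENNReal.ofReal_le_ofReal (by linarith)
  obtain ⟨K, hK⟩ := exists_lintegral_cauchyKernel_le hq hq'1 hq'
  obtain ⟨D, hD⟩ := exists_lintegral_rpow_le hp'0 (by linarith) (hp'q'.trans hqq') hqp s
  obtain ⟨D', hD'⟩ := exists_lintegral_rpow_le hp'0 (by linarith) hp'q' (hqq'.trans hqp) s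
  let B : ℝ≥0 := K * (D ^ (1 / q) + D' ^ (1 / q'))
  refine ⟨Real.exp (2 * B), Real.exp_pos _, ?_⟩
  intro f fbar L A M hf hf0 hf1 hfbar hM hL hAp hAp' hs hle
  have hAD := hD A hAp.1 (hs ▸ le_self_add) (hs ▸ le_add_self)
  have hAD' := hD' A hAp.1 (hs ▸ le_self_add) (hs ▸ le_add_self)
  -- exp (Re L) = M/|f| > 1.
  have hre : ∀ z, 0 < (L z).re := by
    intro z
    have h1 : ‖Complex.exp (L z)‖ = ‖(M : ℂ) / f z‖ := congrArg _ (hL.2 z)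
    rw [Complex.norm_exp, norm_div, Complex.norm_real, Real.norm_of_nonneg (by linarith)] at h1
    rw [← Real.one_lt_exp_iff, h1, one_lt_div (norm_pos_iff.2 (hf0 z))]
    linarith [hf1 z]
  have hL0 : ∀ z, L z ∈ Complex.slitPlane := fun z => Or.inl (hre z)
  have hLne : ∀ z, L z ≠ 0 := fun z => Complex.slitPlane_ne_zero (hL0 z)
  have hM0 : (M : ℂ) ≠ 0 := by exact_mod_cast (by linarith : M ≠ 0)
  have hw : Continuous fun z => Complex.log (L z) := hL.1.clog hL0
  have hfL : Continuous fun z => (f z * L z)⁻¹ :=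
    (hf.mul hL.1).inv₀ fun z => mul_ne_zero (hf0 z) (hLne z)
  set g : ℂ → ℂ := fun z => -(fbar z * (f z * L z)⁻¹) with hgdef
  have hg : AEStronglyMeasurable g :=
    (hfbar.2.1.aestronglyMeasurable.mul hfL.aestronglyMeasurable).neg
  have hgA : ∀ᵐ z : ℂ, ‖g z‖ₑ ≤ ‖A z‖ₑ := by
    filter_upwards [hle] with z hz
    rw [← ofReal_norm, ← ofReal_norm]
    refine ENNReal.ofReal_le_ofReal (le_trans ?_ (le_abs_self _))
    rw [hgdef, norm_neg, norm_mul, norm_inv, norm_mul, ← div_eq_mul_inv,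
      div_le_iff₀ (mul_pos (norm_pos_iff.2 (hf0 z)) (norm_pos_iff.2 (hLne z)))]
    linarith
  have hgle : ∀ z, ∫⁻ ζ, ‖g ζ / (z - ζ)‖ₑ ≤ ∫⁻ ζ, ‖A ζ‖ₑ * ‖(z - ζ)⁻¹‖ₑ := by
    intro z
    refine lintegral_mono_ae ?_
    filter_upwards [hgA] with ζ hζ
    rw [div_eq_mul_inv, enorm_mul]
    gcongr
  have hgB : ∀ z, ∫⁻ ζ, ‖g ζ / (z - ζ)‖ₑ ≤ B := by
    intro z
    refine (hgle z).trans ((hK _ hAp.1.enorm z).trans ?_)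
    have e : (B : ℝ≥0∞) = K * ((D : ℝ≥0∞) ^ (1 / q) + (D' : ℝ≥0∞) ^ (1 / q')) := by
      rw [← ENNReal.coe_rpow_of_nonneg _ (by positivity),
        ← ENNReal.coe_rpow_of_nonneg _ (by positivity), ← ENNReal.coe_add, ← ENNReal.coe_mul]
    rw [e]
    gcongr
  have hg0 := tendsto_of_tendsto_of_tendsto_of_le_of_le tendsto_const_nhds
    (tendsto_lintegral_cauchyKernel hq hq'1 hq' hAp.1.enorm (hAD.trans_lt ENNReal.coe_lt_top).ne
      (hAD'.trans_lt ENNReal.coe_lt_top).ne) (fun _ => zero_le) hgle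
  have hwg : ∀ φ : ℂ → ℂ, ContDiff ℝ ∞ φ → HasCompactSupport φ →
      ∫ z, Complex.log (L z) * dbar φ z = -∫ z, g z * φ z := by
    intro φ hφ hc
    rw [integral_log_mul_dbar hM0 hf hf0 hfbar hL hL0 (hφ.of_le (by exact_mod_cast le_top)) hc,
      ← integral_neg]
    congr 1
    ext z
    simp only [hgdef]
    ring
  obtain ⟨hosc, c, hlim⟩ := oscillation_le_of_weakDbar hw (b := Real.pi)
    (fun z => by rw [Complex.log_im]; exact Complex.abs_arg_le_pi _) hg hgB hg0 hwg
  constructor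
  -- Writing f as a continuous function of w transfers the limit of w at infinity to f.
  · have hfeq : ∀ z, f z = M * Complex.exp (-Complex.exp (Complex.log (L z))) := by
      intro z
      have h1 : Complex.exp (L z) = M / f z := hL.2 z
      rw [Complex.exp_log (hLne z), Complex.exp_neg, h1]
      have := hf0 z
      field_simp
    have hflim : Tendsto f (cocompact ℂ) (𝓝 (M * Complex.exp (-Complex.exp c))) := by
      rw [funext hfeq]
      exact (hlim.cexp.neg.cexp).const_mul _
    rw [← coclosedCompact_eq_cocompact] at hflim
    let F := OnePoint.continuousMapMk ⟨f, hf⟩ _ hflim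
    exact ⟨F, F.continuous, fun z => rfl⟩
  · intro z
    have hnorm : ∀ z, ‖L z‖ = Real.exp (Complex.log (L z)).re := fun z => by
      rw [Complex.log_re, Real.exp_log (norm_pos_iff.2 (hLne z))]
    have h1 : |(Complex.log (L z)).re - (Complex.log (L 0)).re| ≤ 2 * B := by
      rw [← Complex.sub_re]
      exact (Complex.abs_re_le_norm _).trans (hosc z 0)
    rw [abs_le] at h1
    rw [hnorm, hnorm, ← Real.exp_sub, ← Real.exp_neg]
    exact ⟨Real.exp_le_exp.2 h1.1, Real.exp_le_exp.2 h1.2⟩
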